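/- Let $\sigma_X^2,\sigma_E^2>0$ and let $c(z)=\sum_{i\ge 0}c_iz^{-i}$ be a causal noise-shaping filter with real square-summable taps and $c_0=1$ (of finite or infinite order), with frequency response $c(e^{j\omega})=\sum_i c_ie^{-j\omega i}$ (an $L^2$ limit) and power spectrum $S(\omega)=|c(e^{j\omega})|^2$. Consider two-description Delta-Sigma quantization with oversampling factor two of an i.i.d. $N(0,\sigma_X^2)$ source, where the quantization error is white Gaussian noise $E_k$ of variance $\sigma_E^2$ independent of the source. Put $$P_{d_c}=\frac1{2\pi}\int_{-\pi/2}^{\pi/2}S(\omega)\,d\omega,\qquad P_{d_s}=\frac1{4\pi}\int_{-\pi}^{\pi}\bigl(S(\omega/2)+S(\omega/2+\pi)\bigr)\,d\omega .$$ The central and side distortions with optimal post-multipliers are $$d_c=\inf_{\beta\in\mathbb R}\mathbb E(\beta(X+N_c)-X)^2,\qquad d_s=\inf_{\alpha\in\mathbb R}\mathbb E(\alpha(X+N_s)-X)^2,$$ with $X\sim N(0,\sigma_X^2)$ independent of $N_c\sim N(0,\sigma_E^2P_{d_c})$ and of $N_s\sim N(0,\sigma_E^2P_{d_s})$. The description rate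 is the mutual information $R=I(A';A'+E)$ in bits, where $A'\sim N\bigl(0,\sigma_X^2+\sigma_E^2\sum_{i\ge1}c_i^2\bigr)$ is the quantizer input and $E\sim N(0,\sigma_E^2)$ is independent of $A'$. The filter is said to achieve the symmetric quadratic Gaussian multiple-description rate-distortion function if $$d_s\ge\sigma_X^2 2^{-2R}\quad\text{and}\quad d_c=\frac{\sigma_X^2 2^{-4R}}{1-(\sqrt{\Pi}-\sqrt{\Delta})^2},\qquad \Pi=\Bigl(1-\frac{d_s}{\sigma_X^2}\Bigr)^2,\quad \Delta=\frac{d_s^2}{\sigma_X^4}-2^{-4R}.$$ The filter is called minimum phase if it is outer in $|z|>1$, that is, $\log S$ is integrable on $(-\pi,\pi]$ and, for some constant $u$ with $|u|=1$, $$c(z)=u\exp\Bigl(\frac1{4\pi}\int_{-\pi}^{\pi}\frac{z+e^{j\omega}}{z-e^{j\omega}}\log S(\omega)\,d\omega\Bigr)\qquad(|z|>1).$$ Lemma. If $c$ achieves the symmetric quadratic Gaussian multiple-description rate-distortion function, then $c$ is minimum phase and there is a real $\delta\ge1$ such that $S(\omega)=\delta^{-1}$ for almost every $|\omega|<\pi/2$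 and $S(\omega)=\delta$ for almost every $\pi/2<|\omega|<\pi$. Moreover $c$ is of infinite order (infinitely many $c_i\ne0$), except in the trivial case $\delta=1$, $c(z)=1$. -/

import Mathlib

open MeasureTheory ProbabilityTheory

noncomputable section

namespace DeltaSigma

/-! ### Noise-shaping filters

A causal filter `c(z) = ∑_{i ≥ 0} c_i z^{-i}` with real taps is its impulse response `c : ℕ → ℝ`. -/

instance factTwoPiPos : Fact (0 < 2 * Real.pi) := ⟨Real.two_pi_pos⟩

/-- The frequency response `c(e^{jω}) = ∑_i c_i e^{-jωi}` of a square-summable filter, as an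
element of `L²` of the circle `ℝ / 2πℤ` (the series converges in `L²`). -/
def freqResponse (c : ℕ → ℝ) :
    Lp ℂ 2 (AddCircle.haarAddCircle : Measure (AddCircle (2 * Real.pi))) :=
  ∑' i : ℕ, (c i : ℂ) • fourierLp (T := 2 * Real.pi) 2 (-(i : ℤ))

/-- The power spectrum `|c(e^{jω})|²`; it is determined up to a null set of frequencies. -/
def powerSpectrum (c : ℕ → ℝ) (ω : ℝ) : ℝ :=
  ‖freqResponse c (ω : AddCircle (2 * Real.pi))‖ ^ 2

/-- The transfer function `c(z) = ∑_i c_i z^{-i}`; used for `|z| > 1`. -/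
def transfer (c : ℕ → ℝ) (z : ℂ) : ℂ := ∑' i : ℕ, (c i : ℂ) * z⁻¹ ^ i

/-- Minimum phase (for general square-summable filters): the transfer function is outer in
`|z| > 1`, that is, up to a unimodular constant it is recovered from the log power spectrum by
the Herglotz integral.  For rational filters this says that there is no zero in `|z| > 1`. -/
def IsMinimumPhase (c : ℕ → ℝ) : Prop :=
  IntegrableOn (fun ω => Real.log (powerSpectrum c ω)) (Set.Ioc (-Real.pi) Real.pi) ∧
  ∃ u : ℂ, ‖u‖ = 1 ∧ ∀ z : ℂ, 1 < ‖z‖ →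
    transfer c z = u * Complex.exp ((1 / (4 * Real.pi) : ℂ) *
      ∫ ω in (-Real.pi)..Real.pi,
        (z + Complex.exp (ω * Complex.I)) / (z - Complex.exp (ω * Complex.I)) *
          (Real.log (powerSpectrum c ω) : ℂ))

/-- Infinite order: the filter is not of the form `∑_{i ≤ p} c_i z^{-i}` for any `p`. -/
def HasInfiniteOrder (c : ℕ → ℝ) : Prop := ¬ ∃ p : ℕ, ∀ i, p < i → c i = 0

/-! ### Performance of two-times oversampled multiple-description Delta-Sigma quantization

The quantization error is white Gaussian noise of variance `σE2`, independent of the source;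
the shaped noise has spectrum `σE2 * |c(e^{jω})|²`. -/

/-- In-band power of the shaped noise, per unit of `σE2`: this is what is left after the ideal
half-band lowpass filter and downsampling by two in the central decoder. -/
def centralPower (c : ℕ → ℝ) : ℝ :=
  1 / (2 * Real.pi) * ∫ ω in (-(Real.pi / 2))..(Real.pi / 2), powerSpectrum c ω

/-- Power of the shaped noise after downsampling by two without an anti-aliasing filter, per unit
of `σE2`.  It is the same for the even and for the odd samples, and an all-pass filter does not
change it. -/
def sidePower (c : ℕ → ℝ) : ℝ :=
  1 / (4 * Real.pi) * ∫ ω in (-Real.pi)..Real.pi,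
    (powerSpectrum c (ω / 2) + powerSpectrum c (ω / 2 + Real.pi))

/-- Mean-square error `𝔼 (g U - X)²` of the reconstruction `g U`, where `U = X + N` with
independent `X ∼ N(0, vX)` and `N ∼ N(0, vN)`. -/
def mse (vX vN : NNReal) (g : ℝ) : ℝ :=
  ∫ p : ℝ × ℝ, (g * (p.1 + p.2) - p.1) ^ 2 ∂((gaussianReal 0 vX).prod (gaussianReal 0 vN))

/-- The distortion with the optimal post-multiplier. -/
def distortion (vX vN : NNReal) : ℝ := ⨅ g : ℝ, mse vX vN g

/-- Central distortion `d_c`. -/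
def centralDistortion (σX2 σE2 : NNReal) (c : ℕ → ℝ) : ℝ :=
  distortion σX2 (σE2 * (centralPower c).toNNReal)

/-- Side distortion `d_s`, common to the two descriptions. -/
def sideDistortion (σX2 σE2 : NNReal) (c : ℕ → ℝ) : ℝ :=
  distortion σX2 (σE2 * (sidePower c).toNNReal)

/-- Mutual information, in bits, of a pair of real random variables with joint law `μ`. -/
def mutualInfo (μ : Measure (ℝ × ℝ)) : ℝ :=
  (InformationTheory.klDiv μ (μ.fst.prod μ.snd)).toReal / Real.log 2

/-- Variance of the quantizer input `A'_k = A_k + ∑_{i ≥ 1} c_i E_{k-i}`: the oversampled source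
`A_k` has variance `σX2`, and the errors `E_k` are white and independent of the source. -/
def quantizerInputVar (σX2 σE2 : NNReal) (c : ℕ → ℝ) : NNReal :=
  σX2 + σE2 * (∑' i : ℕ, c (i + 1) ^ 2).toNNReal

/-- The description rate `R = I(A'_k ; A'_k + E_k)` in bits per sample, with independent Gaussian
`A'_k` and `E_k`. -/
def descriptionRate (σX2 σE2 : NNReal) (c : ℕ → ℝ) : ℝ :=
  mutualInfo (((gaussianReal 0 (quantizerInputVar σX2 σE2 c)).prod (gaussianReal 0 σE2)).map
    (fun p : ℝ × ℝ => (p.1, p.1 + p.2)))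

/-! ### The symmetric quadratic Gaussian multiple-description rate-distortion function -/

/-- `Π = (1 - d_s / σ_X²)²`. -/
def ozarowPi (vX ds : ℝ) : ℝ := (1 - ds / vX) ^ 2

/-- `Δ = d_s² / σ_X⁴ - 2^{-4R}`. -/
def ozarowDelta (vX R ds : ℝ) : ℝ := ds ^ 2 / vX ^ 2 - (2 : ℝ) ^ (-4 * R)

/-- The least central distortion at description rate `R` and side distortion `ds`. -/
def ozarowCentral (vX R ds : ℝ) : ℝ :=
  vX * (2 : ℝ) ^ (-4 * R) /
    (1 - (Real.sqrt (ozarowPi vX ds) - Real.sqrt (ozarowDelta vX R ds)) ^ 2)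

/-- The filter `c` achieves the symmetric two-channel rate-distortion function at its own
description rate: the side distortion is admissible and the central distortion meets Ozarow's
lower bound. -/
def AchievesRDF (σX2 σE2 : NNReal) (c : ℕ → ℝ) : Prop :=
  σX2 * (2 : ℝ) ^ (-2 * descriptionRate σX2 σE2 c) ≤ sideDistortion σX2 σE2 c ∧
  centralDistortion σX2 σE2 c =
    ozarowCentral σX2 (descriptionRate σX2 σE2 c) (sideDistortion σX2 σE2 c)

end DeltaSigma

end

/-!
Let `S` be the power spectrum, `s = ∑ c_i²` its mean over all frequencies, and `p` its in-band
power, so that the in-band average of `S` is `2p`.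

*Reduction to powers.*  Wiener gains and the mutual information of a Gaussian channel turn all the
quantities into rational functions of `σX2`, `σE2`, `s` and `p`, and Ozarow's bound is then met
exactly when `2p = s - √(s² - 1)` (`AchievesRDF.centralPower_mul_eq_one`).  In other words, the
in-band average of `S` is `δ⁻¹` and its out-of-band average is `δ`, where `δ = s + √(s² - 1)`.

*Rigidity.*  The classical argument would combine Jensen's inequality on each band with Szegő's
theorem for the monic filter `c`.  There is a direct way to obtain the case of equality.  For
`κ = (2 / π) log δ` the function `F ζ = exp (κ arctan ζ)` is bounded and outer in the unit disc,
`F 0 = 1`, and `|F (e^{-jω})|²` is `δ` in band and `δ⁻¹` out of band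
(`norm_halfBand_of_re_pos`, `norm_halfBand_of_re_neg`).  As `F` whitens the prescribed spectrum,
the product `c F` has energy `δ⁻¹ s + (δ - δ⁻¹) p = 1` (`integral_norm_sq_mul_halfBand`).  It is
also causal and monic, hence has mean `1`.  A function of mean `1` and energy `1` is the constant
`1`, so `c = 1 / F = exp (-κ arctan ζ)` with `ζ = 1 / z` (`freqResponse_ae_eq_halfBand`).

*Consequences.*  The spectrum of `1 / F` is the two-level one, and its taps are its Taylor
coefficients, because the Fourier coefficients of the boundary values of a bounded holomorphic
function are limits of those on smaller circles (`integral_fourier_mul_boundary`).  The Herglotz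
integral of the two-level log spectrum is elementary and gives back `-κ arctan ζ`
(`herglotz_integral_halfBand`), which is the minimum-phase property.  If `c` had finite order,
`1 / F` would be a polynomial, of continuous modulus at `ω = π / 2`; this forces `δ = δ⁻¹`, that
is `δ = 1` and `s = 1`.
-/

noncomputable section

namespace DeltaSigma

open AddCircle Filter Topology

local notation "𝕋" => AddCircle (2 * Real.pi)
local notation "haar" => (AddCircle.haarAddCircle : Measure (AddCircle (2 * Real.pi)))

/-! ### Distortion and mutual information for Gaussian variables -/

lemma integral_sq_gaussianReal (v : NNReal) : ∫ x, x ^ 2 ∂(gaussianReal 0 v) = v := by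
  have h := variance_fun_id_gaussianReal (μ := 0) (v := v)
  rwa [variance_of_integral_eq_zero (by fun_prop) (by simp)] at h

lemma integrable_pow_gaussianReal (v : NNReal) (n : ℕ) :
    Integrable (fun x : ℝ => x ^ n) (gaussianReal 0 v) := by
  rcases Nat.eq_zero_or_pos n with rfl | hn
  · simp
  · have := (memLp_id_gaussianReal' (μ := 0) (v := v) (n : ENNReal)
      (by simp)).integrable_norm_pow hn.ne'
    refine (integrable_norm_iff (by fun_prop)).1 ?_
    simpa [norm_pow] using this

lemma integral_linear_sq_gaussianReal (v w : NNReal) (a b : ℝ) :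
    Integrable (fun p : ℝ × ℝ => (a * p.1 + b * p.2) ^ 2)
      ((gaussianReal 0 v).prod (gaussianReal 0 w)) ∧
    ∫ p : ℝ × ℝ, (a * p.1 + b * p.2) ^ 2 ∂((gaussianReal 0 v).prod (gaussianReal 0 w)) =
      a ^ 2 * v + b ^ 2 * w := by
  have h1 : Integrable (fun p : ℝ × ℝ => a ^ 2 * p.1 ^ 2)
      ((gaussianReal 0 v).prod (gaussianReal 0 w)) :=
    ((integrable_pow_gaussianReal v 2).comp_fst _).const_mul _
  have h2 : Integrable (fun p : ℝ × ℝ => b ^ 2 * p.2 ^ 2)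
      ((gaussianReal 0 v).prod (gaussianReal 0 w)) :=
    ((integrable_pow_gaussianReal w 2).comp_snd _).const_mul _
  have hi : ∀ u : NNReal, Integrable (fun x : ℝ => x) (gaussianReal 0 u) := fun u => by
    simpa using integrable_pow_gaussianReal u 1
  have h3 : Integrable (fun p : ℝ × ℝ => 2 * a * b * (p.1 * p.2))
      ((gaussianReal 0 v).prod (gaussianReal 0 w)) :=
    ((hi v).mul_prod (hi w)).const_mul _
  have he : (fun p : ℝ × ℝ => (a * p.1 + b * p.2) ^ 2) =
      fun p => a ^ 2 * p.1 ^ 2 + b ^ 2 * p.2 ^ 2 + 2 * a * b * (p.1 * p.2) := by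
    ext p; ring
  rw [he]
  have h12 : Integrable (fun p : ℝ × ℝ => a ^ 2 * p.1 ^ 2 + b ^ 2 * p.2 ^ 2)
      ((gaussianReal 0 v).prod (gaussianReal 0 w)) := h1.add h2
  refine ⟨h12.add h3, ?_⟩
  rw [integral_add h12 h3, integral_add h1 h2, integral_const_mul, integral_const_mul,
    integral_const_mul, integral_prod_mul (fun x : ℝ => x) (fun y : ℝ => y),
    integral_fun_fst (fun x : ℝ => x ^ 2), integral_fun_snd (fun x : ℝ => x ^ 2),
    integral_sq_gaussianReal, integral_sq_gaussianReal]
  simp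

lemma mse_eq (vX vN : NNReal) (g : ℝ) : mse vX vN g = (g - 1) ^ 2 * vX + g ^ 2 * vN := by
  rw [mse, ← (integral_linear_sq_gaussianReal vX vN (g - 1) g).2]
  congr 1; ext p; ring

/-- The optimal multiplier is the Wiener gain `vX / (vX + vN)`. -/
lemma distortion_eq (vX vN : NNReal) (hX : 0 < vX) :
    distortion vX vN = vX * vN / (vX + vN) := by
  have hX' : (0 : ℝ) < vX := hX
  have hN : (0 : ℝ) ≤ vN := vN.2
  have hs : (0 : ℝ) < vX + vN := by positivity
  have key : ∀ g, mse vX vN g = vX * vN / (vX + vN) + (vX + vN) * (g - vX / (vX + vN)) ^ 2 := by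
    intro g; rw [mse_eq]; field_simp; ring
  have hlb : ∀ g, (vX * vN / (vX + vN) : ℝ) ≤ mse vX vN g := fun g => by
    rw [key]; exact le_add_of_nonneg_right (by positivity)
  refine le_antisymm ?_ (le_ciInf hlb)
  refine (ciInf_le ⟨_, Set.forall_mem_range.2 hlb⟩ (vX / (vX + vN) : ℝ)).trans (le_of_eq ?_)
  rw [key]; simp

/-- Joint law of the input and output of an additive Gaussian channel, as a density with respect
to the product of the marginals. -/
lemma map_gaussian_channel_eq_withDensity (v w : NNReal) (hw : w ≠ 0) :
    ((gaussianReal 0 v).prod (gaussianReal 0 w)).map (fun p : ℝ × ℝ => (p.1, p.1 + p.2)) =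
      ((gaussianReal 0 v).prod (gaussianReal 0 (v + w))).withDensity
        (fun p => gaussianPDF p.1 w p.2 / gaussianPDF 0 (v + w) p.2) := by
  have hvw : v + w ≠ 0 := by simp [hw]
  have hm2 : Measurable (fun p : ℝ × ℝ => gaussianPDF p.1 w p.2) :=
    measurable_uncurry_gaussianPDF.comp
      (measurable_fst.prodMk (measurable_const.prodMk measurable_snd))
  have hm : Measurable (fun p : ℝ × ℝ => gaussianPDF p.1 w p.2 / gaussianPDF 0 (v + w) p.2) :=
    hm2.div ((measurable_gaussianPDF 0 (v + w)).comp measurable_snd)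
  refine Measure.ext_of_lintegral _ fun f hf => ?_
  rw [lintegral_map hf (by fun_prop), lintegral_withDensity_eq_lintegral_mul _ hm hf,
    lintegral_prod _ (by fun_prop), lintegral_prod _ (by fun_prop)]
  refine lintegral_congr fun x => ?_
  have h1 : ∫⁻ y, f (x, x + y) ∂gaussianReal 0 w = ∫⁻ y, f (x, y) ∂gaussianReal x w := by
    have h := gaussianReal_map_const_add (μ := 0) (v := w) x
    rw [zero_add] at h
    rw [← h, lintegral_map (by fun_prop) (by fun_prop)]
  rw [h1, gaussianReal_of_var_ne_zero _ hw, gaussianReal_of_var_ne_zero _ hvw,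
    lintegral_withDensity_eq_lintegral_mul _ (measurable_gaussianPDF _ _) (by fun_prop),
    lintegral_withDensity_eq_lintegral_mul _ (measurable_gaussianPDF _ _) (by fun_prop)]
  refine lintegral_congr fun y => ?_
  simp only [Pi.mul_apply]
  rw [← mul_assoc, ENNReal.mul_div_cancel (gaussianPDF_pos _ hvw _).ne' gaussianPDF_ne_top]

lemma log_gaussianPDFReal (m : ℝ) (v : NNReal) (hv : v ≠ 0) (x : ℝ) :
    Real.log (gaussianPDFReal m v x) =
      -(Real.log (2 * Real.pi * v)) / 2 - (x - m) ^ 2 / (2 * v) := by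
  have : (0 : ℝ) < v := NNReal.coe_pos.2 hv.bot_lt
  rw [gaussianPDFReal, Real.log_mul (by positivity) (Real.exp_pos _).ne', Real.log_exp,
    Real.log_inv, Real.log_sqrt (by positivity)]
  ring

/-- The mutual information across an additive Gaussian channel is `½ log₂ (1 + v / w)`. -/
lemma mutualInfo_gaussian_channel (v w : NNReal) (hw : w ≠ 0) :
    mutualInfo (((gaussianReal 0 v).prod (gaussianReal 0 w)).map
      (fun p : ℝ × ℝ => (p.1, p.1 + p.2))) =
      Real.log ((v + w) / w) / 2 / Real.log 2 := by
  have hvw : v + w ≠ 0 := by simp [hw]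
  have hw' : (0 : ℝ) < w := NNReal.coe_pos.2 hw.bot_lt
  have hvw' : (0 : ℝ) < v + w := by positivity
  set P := (gaussianReal 0 v).prod (gaussianReal 0 w) with hP
  set μ := P.map (fun p : ℝ × ℝ => (p.1, p.1 + p.2)) with hμ
  have hfst : μ.fst = gaussianReal 0 v := by
    rw [hμ, Measure.fst, Measure.map_map (by fun_prop) (by fun_prop)]
    exact Measure.fst_prod
  have hsnd : μ.snd = gaussianReal 0 (v + w) := by
    rw [hμ, Measure.snd, Measure.map_map (by fun_prop) (by fun_prop)]
    have := gaussianReal_conv_gaussianReal (m₁ := 0) (m₂ := 0) (v₁ := v) (v₂ := w)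
    rw [add_zero] at this
    rw [← this]; rfl
  rw [mutualInfo, hfst, hsnd]
  set ν := (gaussianReal 0 v).prod (gaussianReal 0 (v + w))
  have hd : μ = ν.withDensity (fun p => gaussianPDF p.1 w p.2 / gaussianPDF 0 (v + w) p.2) :=
    map_gaussian_channel_eq_withDensity v w hw
  have hm2 : Measurable (fun p : ℝ × ℝ => gaussianPDF p.1 w p.2) :=
    measurable_uncurry_gaussianPDF.comp
      (measurable_fst.prodMk (measurable_const.prodMk measurable_snd))
  have hm : Measurable (fun p : ℝ × ℝ => gaussianPDF p.1 w p.2 / gaussianPDF 0 (v + w) p.2) :=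
    hm2.div ((measurable_gaussianPDF 0 (v + w)).comp measurable_snd)
  have hac : μ ≪ ν := by rw [hd]; exact withDensity_absolutelyContinuous _ _
  have hprob : IsProbabilityMeasure μ := Measure.isProbabilityMeasure_map (by fun_prop)
  rw [InformationTheory.toReal_klDiv_of_measure_eq hac (by simp)]
  have hrn : μ.rnDeriv ν =ᵐ[ν] fun p => gaussianPDF p.1 w p.2 / gaussianPDF 0 (v + w) p.2 := by
    rw [hd]; exact Measure.rnDeriv_withDensity _ hm
  have hllr : ∀ᵐ p ∂μ, llr μ ν p = Real.log ((v + w) / w) / 2 +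
      (p.2 ^ 2 / (2 * (v + w)) - (p.2 - p.1) ^ 2 / (2 * w)) := by
    filter_upwards [hac.ae_le hrn] with p hp
    rw [llr, hp, ENNReal.toReal_div, toReal_gaussianPDF, toReal_gaussianPDF,
      Real.log_div (gaussianPDFReal_pos _ _ _ hw).ne' (gaussianPDFReal_pos _ _ _ hvw).ne',
      log_gaussianPDFReal _ _ hw, log_gaussianPDFReal _ _ hvw, NNReal.coe_add,
      Real.log_div hvw'.ne' hw'.ne', Real.log_mul (by positivity) hw'.ne',
      Real.log_mul (by positivity) hvw'.ne']
    ring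
  rw [integral_congr_ae hllr, hμ, integral_map (by fun_prop) (by fun_prop)]
  obtain ⟨i1, e1⟩ := integral_linear_sq_gaussianReal v w 1 1
  obtain ⟨i2, e2⟩ := integral_linear_sq_gaussianReal v w 0 1
  simp only [one_mul, zero_mul, zero_add] at i1 e1 i2 e2
  simp only [add_sub_cancel_left]
  have i1' := i1.div_const (2 * (v + w : ℝ))
  have i2' := i2.div_const (2 * w : ℝ)
  have i12 : Integrable (fun x : ℝ × ℝ =>
      (x.1 + x.2) ^ 2 / (2 * (v + w : ℝ)) - x.2 ^ 2 / (2 * w)) P := i1'.sub i2'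
  rw [integral_add (integrable_const _) i12, integral_sub i1' i2', integral_const]
  simp only [integral_div, e1, e2, probReal_univ, one_smul]
  field_simp
  ring

/-! ### Fourier series of the frequency response, and noise powers -/

lemma hasSum_freqResponse {c : ℕ → ℝ} (hsum : Summable fun i => c i ^ 2) :
    HasSum (fun i : ℕ => (c i : ℂ) • fourierLp (T := 2 * Real.pi) 2 (-(i : ℤ)))
      (freqResponse c) := by
  have ho : Orthonormal ℂ (fun i : ℕ => fourierLp (T := 2 * Real.pi) 2 (-(i : ℤ))) :=
    orthonormal_fourier.comp _ (fun i j h => by simpa using h)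
  have h := ho.orthogonalFamily.summable_iff_norm_sq_summable (fun i : ℕ => (c i : ℂ))
  refine (h.2 ?_).hasSum
  simpa using hsum

/-- Pairing the frequency response with an `L²` function may be done tap by tap. -/
lemma hasSum_integral_mul_freqResponse {c : ℕ → ℝ} (hsum : Summable fun i => c i ^ 2)
    {g : 𝕋 → ℂ} (hg : MemLp g 2 haar) :
    HasSum (fun i : ℕ => (c i : ℂ) * ∫ x, fourier (-(i : ℤ)) x * g x ∂haar)
      (∫ x, freqResponse c x * g x ∂haar) := by
  have hg' : MemLp (fun x => star (g x)) 2 haar := hg.star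
  have hin : ∀ f : Lp ℂ 2 haar,
      inner ℂ (hg'.toLp _) f = ∫ x, f x * g x ∂haar := by
    intro f
    rw [L2.inner_def]
    refine integral_congr_ae ?_
    filter_upwards [hg'.coeFn_toLp] with x hx
    rw [hx]; simp
  have h := (hasSum_freqResponse hsum).mapL (innerSL ℂ (hg'.toLp _))
  have he : ∀ i : ℕ, innerSL ℂ (hg'.toLp _) ((c i : ℂ) • fourierLp (T := 2 * Real.pi) 2 (-(i : ℤ)))
      = (c i : ℂ) * ∫ x, fourier (-(i : ℤ)) x * g x ∂haar := by
    intro i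
    rw [innerSL_apply_apply, inner_smul_right, hin]
    congr 1
    refine integral_congr_ae ?_
    filter_upwards [coeFn_fourierLp (T := 2 * Real.pi) 2 (-(i : ℤ))] with x hx
    rw [hx]
  simp only [he] at h
  rwa [innerSL_apply_apply, hin] at h

lemma integral_fourier (n : ℤ) : ∫ x, (fourier n x : ℂ) ∂haar = if n = 0 then 1 else 0 := by
  have h := congrFun (fourierCoeff_fourier (T := 2 * Real.pi) n) 0
  simp only [fourierCoeff, neg_zero, fourier_zero, one_smul] at h
  rw [h, Pi.single_apply]
  simp [eq_comm]

lemma memLp_fourier (n : ℤ) : MemLp (fun x => (fourier n x : ℂ)) 2 haar :=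
  (map_continuous (fourier n)).memLp_of_hasCompactSupport (HasCompactSupport.of_compactSpace _)

lemma integral_fourier_mul_freqResponse {c : ℕ → ℝ} (hsum : Summable fun i => c i ^ 2) (n : ℕ) :
    ∫ x, freqResponse c x * fourier n x ∂haar = c n := by
  have h := hasSum_integral_mul_freqResponse hsum (memLp_fourier n)
  simp_rw [← fourier_add, integral_fourier] at h
  refine h.unique ?_
  convert hasSum_ite_eq n (c n : ℂ) using 2 with i
  by_cases hi : i = n
  · simp [hi]
  · rw [if_neg (by omega), if_neg hi, mul_zero]

/-- The total power of the shaped noise is the energy of the filter. -/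
lemma integral_norm_sq_freqResponse {c : ℕ → ℝ} (hsum : Summable fun i => c i ^ 2) :
    ∫ x, ‖freqResponse c x‖ ^ 2 ∂haar = ∑' i, c i ^ 2 := by
  have h := hasSum_integral_mul_freqResponse hsum (Lp.memLp (freqResponse c)).star
  have h2 : ∀ i : ℕ, ∫ x, fourier (-(i : ℤ)) x * (star (⇑(freqResponse c)) : 𝕋 → ℂ) x ∂haar
      = c i := by
    intro i
    have h3 := congrArg star (integral_fourier_mul_freqResponse hsum i)
    simp only [RCLike.star_def, ← integral_conj] at h3
    rw [Complex.conj_ofReal] at h3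
    rw [← h3]
    congr 1; ext x
    rw [map_mul, ← fourier_neg, mul_comm]
    rfl
  simp only [h2] at h
  have h4 : ∫ x, freqResponse c x * (star (⇑(freqResponse c)) : 𝕋 → ℂ) x ∂haar =
      ((∫ x, ‖freqResponse c x‖ ^ 2 ∂haar : ℝ) : ℂ) := by
    rw [← integral_complex_ofReal]
    congr 1; ext x
    simp [RCLike.mul_conj]
  rw [h4] at h
  have h5 : HasSum (fun i => c i ^ 2) (∫ x, ‖freqResponse c x‖ ^ 2 ∂haar) := by
    have := Complex.hasSum_re h
    simpa [sq] using this
  exact h5.tsum_eq.symm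

lemma integrable_norm_sq_freqResponse (c : ℕ → ℝ) :
    Integrable (fun x => ‖freqResponse c x‖ ^ 2) haar :=
  (memLp_two_iff_integrable_sq_norm (Lp.aestronglyMeasurable _)).1 (Lp.memLp (freqResponse c))

lemma integral_haar_eq_setIntegral (g : 𝕋 → ℝ) :
    ∫ x, g x ∂haar = 1 / (2 * Real.pi) * ∫ ω in Set.Ioc (-Real.pi) Real.pi, g (ω : 𝕋) := by
  rw [integral_haarAddCircle, ← AddCircle.integral_preimage (2 * Real.pi) (-Real.pi) g,
    show -Real.pi + 2 * Real.pi = Real.pi by ring]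
  simp

lemma ae_haar_eq_ae_volume : ae haar = ae (volume : Measure 𝕋) := by
  rw [volume_eq_smul_haarAddCircle, Measure.ae_ennreal_smul_measure_eq]
  simpa using Real.pi_pos

lemma measurePreserving_coe : MeasurePreserving ((↑) : ℝ → 𝕋)
    (volume.restrict (Set.Ioc (-Real.pi) Real.pi)) volume := by
  have := AddCircle.measurePreserving_mk (2 * Real.pi) (-Real.pi)
  rwa [show -Real.pi + 2 * Real.pi = Real.pi by ring] at this

lemma ae_coe_of_ae_haar {P : 𝕋 → Prop} (h : ∀ᵐ x ∂haar, P x) :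
    ∀ᵐ ω : ℝ ∂volume.restrict (Set.Ioc (-Real.pi) Real.pi), P (ω : 𝕋) := by
  rw [ae_haar_eq_ae_volume] at h
  exact measurePreserving_coe.quasiMeasurePreserving.ae h

lemma ae_haar_of_ae_coe {P : 𝕋 → Prop} (hP : MeasurableSet {x | P x})
    (h : ∀ᵐ ω : ℝ ∂volume.restrict (Set.Ioc (-Real.pi) Real.pi), P (ω : 𝕋)) :
    ∀ᵐ x ∂haar, P x := by
  rw [ae_haar_eq_ae_volume, ← measurePreserving_coe.map_eq]
  exact (ae_map_iff measurePreserving_coe.measurable.aemeasurable hP).2 h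

lemma periodic_powerSpectrum (c : ℕ → ℝ) : Function.Periodic (powerSpectrum c) (2 * Real.pi) := by
  intro ω; simp [powerSpectrum]

lemma intervalIntegrable_powerSpectrum (c : ℕ → ℝ) (a b : ℝ) :
    IntervalIntegrable (powerSpectrum c) volume a b := by
  refine (periodic_powerSpectrum c).intervalIntegrable (t := -Real.pi) Real.two_pi_pos.ne' ?_ a b
  rw [intervalIntegrable_iff_integrableOn_Ioc_of_le (by linarith [Real.pi_pos]),
    show -Real.pi + 2 * Real.pi = Real.pi by ring]
  have h : Integrable (fun x : 𝕋 => ‖freqResponse c x‖ ^ 2) volume := by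
    rw [volume_eq_smul_haarAddCircle]
    exact (integrable_norm_sq_freqResponse c).smul_measure ENNReal.ofReal_ne_top
  exact measurePreserving_coe.integrable_comp_of_integrable h

lemma sidePower_eq {c : ℕ → ℝ} (hsum : Summable fun i => c i ^ 2) :
    sidePower c = ∑' i, c i ^ 2 := by
  have hpi := Real.pi_pos
  rw [← integral_norm_sq_freqResponse hsum, integral_haar_eq_setIntegral,
    ← intervalIntegral.integral_of_le (by linarith), sidePower]
  have hi := intervalIntegrable_powerSpectrum c
  have h1 : IntervalIntegrable (fun ω => powerSpectrum c (ω / 2)) volume (-Real.pi) Real.pi := by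
    have := (hi (-Real.pi / 2) (Real.pi / 2)).comp_mul_right (c := 2⁻¹)
    simpa [div_eq_mul_inv] using this
  have h2 : IntervalIntegrable (fun ω => powerSpectrum c (ω / 2 + Real.pi)) volume
      (-Real.pi) Real.pi := by
    have := ((hi (-Real.pi / 2 + Real.pi) (Real.pi / 2 + Real.pi)).comp_add_right
      Real.pi).comp_mul_right (c := 2⁻¹)
    simpa [div_eq_mul_inv] using this
  rw [intervalIntegral.integral_add h1 h2,
    intervalIntegral.integral_comp_div (fun ω => powerSpectrum c ω) two_ne_zero,
    intervalIntegral.integral_comp_div_add (fun ω => powerSpectrum c ω) two_ne_zero,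
    ← smul_add, show -Real.pi / 2 + Real.pi = Real.pi / 2 by ring,
    intervalIntegral.integral_add_adjacent_intervals (hi _ _) (hi _ _)]
  have := (periodic_powerSpectrum c).intervalIntegral_add_eq (-Real.pi) (-Real.pi / 2)
  rw [show -Real.pi + 2 * Real.pi = Real.pi by ring,
    show -Real.pi / 2 + 2 * Real.pi = Real.pi / 2 + Real.pi by ring] at this
  rw [← this, smul_eq_mul]
  simp only [powerSpectrum]
  ring

lemma centralPower_nonneg (c : ℕ → ℝ) : 0 ≤ centralPower c := by
  have hpi := Real.pi_pos
  refine mul_nonneg (by positivity) (intervalIntegral.integral_nonneg (by linarith) ?_)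
  intro ω _; simp only [powerSpectrum]; positivity

/-! ### Boundary values of bounded holomorphic functions -/

/-- The point `e^{-jω}` of the unit circle. -/
def delay (x : 𝕋) : ℂ := fourier (-1) x

lemma continuous_delay : Continuous delay := map_continuous (fourier (-1))

lemma norm_fourier_apply (n : ℤ) (x : 𝕋) : ‖(fourier n x : ℂ)‖ = 1 := by
  rw [fourier_apply, Circle.norm_coe]

lemma norm_delay (x : 𝕋) : ‖delay x‖ = 1 := norm_fourier_apply _ _

lemma delay_pow (x : 𝕋) (n : ℕ) : delay x ^ n = fourier (-(n : ℤ)) x := by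
  induction n with
  | zero => simp
  | succ n ih =>
    rw [pow_succ, ih, delay, ← fourier_add, Nat.cast_succ, neg_add]

lemma delay_coe (ω : ℝ) : delay (ω : 𝕋) = Complex.exp (-(ω * Complex.I)) := by
  rw [delay, fourier_coe_apply]
  congr 1
  have : (Real.pi : ℂ) ≠ 0 := by exact_mod_cast Real.pi_ne_zero
  push_cast
  field_simp

lemma delay_coe_re (ω : ℝ) : (delay (ω : 𝕋)).re = Real.cos ω := by
  rw [delay_coe, ← neg_mul, ← Complex.ofReal_neg, Complex.exp_ofReal_mul_I_re, Real.cos_neg]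

lemma ae_delay_re_ne_zero : ∀ᵐ x ∂haar, (delay x).re ≠ 0 := by
  refine ae_haar_of_ae_coe (P := fun x => (delay x).re ≠ 0) ?_ (ae_restrict_of_ae ?_)
  · exact (isOpen_ne_fun (Complex.continuous_re.comp continuous_delay)
      continuous_const).measurableSet
  · simp only [delay_coe_re]
    have hc : {ω : ℝ | Real.cos ω = 0}.Countable := by
      refine (Set.countable_range (fun k : ℤ => (2 * k + 1) * Real.pi / 2)).mono ?_
      intro ω hω
      obtain ⟨k, hk⟩ := Real.cos_eq_zero_iff.1 hω
      exact ⟨k, hk.symm⟩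
    exact (hc.ae_notMem volume).mono fun ω hω => hω

/-- Fourier coefficients of the boundary values of a bounded holomorphic function on the disc. -/
lemma integral_fourier_mul_boundary {Φ : ℂ → ℂ} {a : ℕ → ℂ} {C : ℝ}
    (hcont : ContinuousOn Φ (Metric.ball 0 1))
    (hsum : ∀ z : ℂ, ‖z‖ < 1 → HasSum (fun n => a n * z ^ n) (Φ z))
    (hbdd : ∀ z : ℂ, ‖z‖ < 1 → ‖Φ z‖ ≤ C)
    (hlim : ∀ᵐ x ∂haar, Tendsto (fun r : ℝ => Φ (r * delay x)) (𝓝[<] 1) (𝓝 (Φ (delay x))))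
    (m : ℤ) :
    ∫ x, fourier m x * Φ (delay x) ∂haar = if 0 ≤ m then a m.toNat else 0 := by
  have hnear : ∀ᶠ r : ℝ in 𝓝[<] 1, 0 < r ∧ r < 1 := by
    filter_upwards [Ioo_mem_nhdsLT (zero_lt_one' ℝ)] with r hr using hr
  have hn : ∀ {r : ℝ}, 0 < r ∧ r < 1 → ∀ x, ‖(r : ℂ) * delay x‖ < 1 := by
    intro r hr x
    rw [norm_mul, norm_delay, mul_one, Complex.norm_real, Real.norm_of_nonneg hr.1.le]
    exact hr.2
  -- On a circle of radius `r < 1` the Taylor series may be integrated term by term.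
  have hr_eq : ∀ r : ℝ, 0 < r ∧ r < 1 → ∫ x, fourier m x * Φ (r * delay x) ∂haar =
      if 0 ≤ m then a m.toNat * (r : ℂ) ^ m.toNat else 0 := by
    intro r hr
    have hs : Summable fun n => ‖a n * (r : ℂ) ^ n‖ :=
      (hsum r (by simpa [abs_of_pos hr.1] using hr.2)).summable.norm
    have hterm : ∀ n : ℕ, ∫ x, fourier m x * (a n * ((r : ℂ) * delay x) ^ n) ∂haar =
        if (n : ℤ) = m then a n * (r : ℂ) ^ n else 0 := by
      intro n
      have : (fun x => fourier m x * (a n * ((r : ℂ) * delay x) ^ n)) =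
          fun x : 𝕋 => (a n * (r : ℂ) ^ n) * fourier (m - n) x := by
        ext x
        rw [mul_pow, delay_pow, sub_eq_add_neg, fourier_add]; ring
      rw [this, integral_const_mul, integral_fourier]
      by_cases h : (n : ℤ) = m
      · simp [h]
      · rw [if_neg (by omega), if_neg h, mul_zero]
    have hmeas : ∀ n : ℕ, AEStronglyMeasurable
        (fun x => fourier m x * (a n * ((r : ℂ) * delay x) ^ n)) haar := fun n =>
      ((map_continuous (fourier m)).mul (continuous_const.mul
        ((continuous_const.mul continuous_delay).pow n))).aestronglyMeasurable
    have h1 := hasSum_integral_of_dominated_convergence (μ := haar)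
      (F := fun n x => fourier m x * (a n * ((r : ℂ) * delay x) ^ n))
      (f := fun x => fourier m x * Φ (r * delay x))
      (fun n _ => ‖a n * (r : ℂ) ^ n‖) hmeas
      (fun n => ae_of_all _ fun x => by
        rw [norm_mul, norm_fourier_apply, one_mul, mul_pow, ← mul_assoc, norm_mul,
          norm_pow (delay x), norm_delay, one_pow, mul_one])
      (ae_of_all _ fun _ => hs) (integrable_const _)
      (ae_of_all _ fun x => (hsum _ (hn hr x)).mul_left _)
    simp only [hterm] at h1
    refine h1.unique ?_
    split_ifs with h
    · lift m to ℕ using h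
      have he : (fun n : ℕ => if (n : ℤ) = m then a n * (r : ℂ) ^ n else 0) =
          fun n => if n = m then a m * (r : ℂ) ^ m else 0 := by
        ext n
        by_cases hnm : n = m <;> simp [hnm]
      rw [he]
      exact hasSum_ite_eq m (a m * (r : ℂ) ^ m)
    · convert hasSum_zero using 2 with n
      rw [if_neg (by omega)]
  have hL : Tendsto (fun r : ℝ => ∫ x, fourier m x * Φ (r * delay x) ∂haar) (𝓝[<] 1)
      (𝓝 (∫ x, fourier m x * Φ (delay x) ∂haar)) := by
    refine tendsto_integral_filter_of_dominated_convergence (fun _ => C) ?_ ?_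
      (integrable_const _) ?_
    · filter_upwards [hnear] with r hr
      refine (Continuous.mul (map_continuous _) ?_).aestronglyMeasurable
      exact hcont.comp_continuous (continuous_const.mul continuous_delay)
        (fun x => by simpa using hn hr x)
    · filter_upwards [hnear] with r hr
      refine ae_of_all _ fun x => ?_
      rw [norm_mul, norm_fourier_apply, one_mul]
      exact hbdd _ (hn hr x)
    · filter_upwards [hlim] with x hx using hx.const_mul _
  refine tendsto_nhds_unique hL (Tendsto.congr'
    (f₁ := fun r : ℝ => if 0 ≤ m then a m.toNat * (r : ℂ) ^ m.toNat else 0) ?_ ?_)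
  · filter_upwards [hnear] with r hr using (hr_eq r hr).symm
  · split_ifs
    · have : Tendsto (fun r : ℝ => a m.toNat * (r : ℂ) ^ m.toNat) (𝓝 1)
          (𝓝 (a m.toNat * ((1 : ℝ) : ℂ) ^ m.toNat)) := by
        apply Continuous.tendsto
        fun_prop
      simp only [Complex.ofReal_one, one_pow, mul_one] at this
      exact this.mono_left nhdsWithin_le_nhds
    · exact tendsto_const_nhds

/-! ### The half-band outer function `exp (κ arctan ζ)` -/

/-- The outer function `exp (κ arctan ζ)` of the unit disc.  On the unit circle its modulus takes
the constant values `exp (± κ π / 4)` on the open right and left half circles; at `±i`, where there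
is no radial limit unless `κ = 0`, the value is a conventional `1`. -/
def halfBand (κ : ℝ) (ζ : ℂ) : ℂ := Complex.exp (κ * Complex.arctan ζ)

lemma halfBand_mul_neg (κ : ℝ) (ζ : ℂ) : halfBand κ ζ * halfBand (-κ) ζ = 1 := by
  rw [halfBand, halfBand, ← Complex.exp_add]; simp

lemma halfBand_zero_right (κ : ℝ) : halfBand κ 0 = 1 := by simp [halfBand, Complex.arctan]

lemma moebius_re (ζ : ℂ) : ((1 + ζ * Complex.I) / (1 - ζ * Complex.I)).re =
    (1 - ‖ζ‖ ^ 2) / Complex.normSq (1 - ζ * Complex.I) := by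
  rw [Complex.div_re, ← add_div, ← Complex.normSq_eq_norm_sq, Complex.normSq_apply ζ]
  congr 1; simp; ring

lemma moebius_im (ζ : ℂ) : ((1 + ζ * Complex.I) / (1 - ζ * Complex.I)).im =
    2 * ζ.re / Complex.normSq (1 - ζ * Complex.I) := by
  rw [Complex.div_im, ← sub_div]
  congr 1; simp; ring

lemma norm_halfBand (κ : ℝ) (ζ : ℂ) : ‖halfBand κ ζ‖ =
    Real.exp (κ * (Complex.arg ((1 + ζ * Complex.I) / (1 - ζ * Complex.I)) / 2)) := by
  rw [halfBand, Complex.norm_exp, Complex.re_ofReal_mul, Complex.arctan]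
  congr 2
  rw [Complex.mul_re, Complex.log_im]
  simp
  ring

lemma one_sub_mul_I_ne_zero {ζ : ℂ} (h : ‖ζ‖ < 1 ∨ ‖ζ‖ = 1 ∧ ζ.re ≠ 0) :
    1 - ζ * Complex.I ≠ 0 := by
  intro h0
  have h1 : ζ = -Complex.I := by
    have : ζ * Complex.I = 1 := (sub_eq_zero.1 h0).symm
    calc ζ = -(ζ * Complex.I) * Complex.I := by
          rw [neg_mul, mul_assoc, Complex.I_mul_I]; ring
      _ = _ := by rw [this]; ring
  rcases h with h | ⟨-, h⟩ <;> simp [h1] at h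

/-- The Möbius map `ζ ↦ (1 + iζ) / (1 - iζ)` sends the closed disc to the closed right half plane,
which bounds the real part of `arctan`. -/
lemma norm_halfBand_le (κ : ℝ) {ζ : ℂ} (h : ‖ζ‖ ≤ 1) :
    ‖halfBand κ ζ‖ ≤ Real.exp (|κ| * (Real.pi / 2 / 2)) := by
  rw [norm_halfBand]
  have h1 : |Complex.arg ((1 + ζ * Complex.I) / (1 - ζ * Complex.I))| ≤ Real.pi / 2 := by
    rw [Complex.abs_arg_le_pi_div_two_iff, moebius_re]
    refine div_nonneg ?_ (Complex.normSq_nonneg _)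
    nlinarith [norm_nonneg ζ]
  refine Real.exp_le_exp.2 ((le_abs_self _).trans ?_)
  rw [abs_mul, abs_div, abs_of_pos (two_pos : (0 : ℝ) < 2)]
  gcongr

lemma norm_halfBand_of_re_pos (κ : ℝ) {ζ : ℂ} (h : ‖ζ‖ = 1) (hre : 0 < ζ.re) :
    ‖halfBand κ ζ‖ = Real.exp (κ * (Real.pi / 4)) := by
  have hn := Complex.normSq_pos.2 (one_sub_mul_I_ne_zero (Or.inr ⟨h, hre.ne'⟩))
  have : Complex.arg ((1 + ζ * Complex.I) / (1 - ζ * Complex.I)) = Real.pi / 2 := by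
    rw [Complex.arg_eq_pi_div_two_iff, moebius_re, moebius_im]
    exact ⟨by simp [h], by positivity⟩
  rw [norm_halfBand, this]; congr 1; ring

lemma norm_halfBand_of_re_neg (κ : ℝ) {ζ : ℂ} (h : ‖ζ‖ = 1) (hre : ζ.re < 0) :
    ‖halfBand κ ζ‖ = Real.exp (-κ * (Real.pi / 4)) := by
  have hn := Complex.normSq_pos.2 (one_sub_mul_I_ne_zero (Or.inr ⟨h, hre.ne⟩))
  have : Complex.arg ((1 + ζ * Complex.I) / (1 - ζ * Complex.I)) = -(Real.pi / 2) := by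
    rw [Complex.arg_eq_neg_pi_div_two_iff, moebius_re, moebius_im]
    exact ⟨by simp [h], div_neg_of_neg_of_pos (by linarith) hn⟩
  rw [norm_halfBand, this]; congr 1; ring

lemma differentiableAt_halfBand (κ : ℝ) {ζ : ℂ} (h : ‖ζ‖ < 1 ∨ ‖ζ‖ = 1 ∧ ζ.re ≠ 0) :
    DifferentiableAt ℂ (halfBand κ) ζ := by
  have h0 := one_sub_mul_I_ne_zero h
  have hn := Complex.normSq_pos.2 h0
  have hs : (1 + ζ * Complex.I) / (1 - ζ * Complex.I) ∈ Complex.slitPlane := by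
    rw [Complex.mem_slitPlane_iff, moebius_re, moebius_im]
    rcases h with h | ⟨-, h⟩
    · left
      have : ‖ζ‖ ^ 2 < 1 := by nlinarith [norm_nonneg ζ]
      exact div_pos (by linarith) hn
    · right; exact div_ne_zero (by simpa using h) hn.ne'
  unfold halfBand Complex.arctan
  have hd : DifferentiableAt ℂ (fun ζ : ℂ => (1 + ζ * Complex.I) / (1 - ζ * Complex.I)) ζ := by
    refine DifferentiableAt.fun_div (by fun_prop) (by fun_prop) h0
  exact (((hd.clog hs).const_mul _).const_mul _).cexp

lemma differentiableOn_halfBand (κ : ℝ) :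
    DifferentiableOn ℂ (halfBand κ) (Metric.ball 0 1) := fun ζ hζ =>
  (differentiableAt_halfBand κ (Or.inl (by simpa using hζ))).differentiableWithinAt

/-- The Taylor coefficients of the half-band outer function at the origin. -/
def halfBandCoeff (κ : ℝ) (n : ℕ) : ℂ := (n.factorial : ℂ)⁻¹ * iteratedDeriv n (halfBand κ) 0

lemma hasSum_halfBand (κ : ℝ) (ζ : ℂ) (h : ‖ζ‖ < 1) :
    HasSum (fun n => halfBandCoeff κ n * ζ ^ n) (halfBand κ ζ) := by
  have := Complex.hasSum_taylorSeries_on_ball (differentiableOn_halfBand κ)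
    (z := ζ) (by simpa using h)
  simp only [smul_eq_mul, sub_zero] at this
  have he : (fun n => halfBandCoeff κ n * ζ ^ n) =
      fun n => (n.factorial : ℂ)⁻¹ * (ζ ^ n * iteratedDeriv n (halfBand κ) 0) := by
    ext n; simp only [halfBandCoeff]; ring
  rwa [he]

lemma halfBandCoeff_zero (κ : ℝ) : halfBandCoeff κ 0 = 1 := by
  simp [halfBandCoeff, halfBand_zero_right]

lemma integral_fourier_mul_halfBand (κ : ℝ) (m : ℤ) :
    ∫ x, fourier m x * halfBand κ (delay x) ∂haar =
      if 0 ≤ m then halfBandCoeff κ m.toNat else 0 := by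
  refine integral_fourier_mul_boundary (differentiableOn_halfBand κ).continuousOn
    (hasSum_halfBand κ) (fun z hz => norm_halfBand_le κ hz.le) ?_ m
  filter_upwards [ae_delay_re_ne_zero] with x hx
  have hc := (differentiableAt_halfBand κ (Or.inr ⟨norm_delay x, hx⟩)).continuousAt
  have hl : Tendsto (fun r : ℝ => (r : ℂ) * delay x) (𝓝[<] 1) (𝓝 (delay x)) := by
    have : Tendsto (fun r : ℝ => (r : ℂ) * delay x) (𝓝 1) (𝓝 (((1 : ℝ) : ℂ) * delay x)) := by
      apply Continuous.tendsto
      fun_prop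
    rw [Complex.ofReal_one, one_mul] at this
    exact this.mono_left nhdsWithin_le_nhds
  exact hc.tendsto.comp hl

lemma aestronglyMeasurable_halfBand_delay (κ : ℝ) :
    AEStronglyMeasurable (fun x => halfBand κ (delay x)) haar := by
  have : Measurable (halfBand κ) := by
    unfold halfBand Complex.arctan
    fun_prop
  exact (this.comp continuous_delay.measurable).aestronglyMeasurable

lemma memLp_halfBand_delay (κ : ℝ) (p : ENNReal) :
    MemLp (fun x => halfBand κ (delay x)) p haar :=
  MemLp.of_bound (aestronglyMeasurable_halfBand_delay κ) _
    (ae_of_all _ fun x => norm_halfBand_le κ (norm_delay x).le)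

/-! ### Whitening by a half-band outer function -/

lemma integral_freqResponse_mul_halfBand {c : ℕ → ℝ} (hmonic : c 0 = 1)
    (hsum : Summable fun i => c i ^ 2) (κ : ℝ) :
    ∫ x, freqResponse c x * halfBand κ (delay x) ∂haar = 1 := by
  have h := hasSum_integral_mul_freqResponse hsum (memLp_halfBand_delay κ 2)
  refine h.unique ?_
  convert hasSum_ite_eq 0 (1 : ℂ) using 2 with i
  rw [integral_fourier_mul_halfBand]
  rcases Nat.eq_zero_or_pos i with rfl | hi
  · simp [hmonic, halfBandCoeff_zero]
  · rw [if_neg (by omega), if_neg hi.ne', mul_zero]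

/-- Whitening rigidity: the product of a monic causal filter with a monic bounded outer function
has mean one, so that it has energy one only if it is identically one. -/
lemma freqResponse_ae_eq_halfBand {c : ℕ → ℝ} (hmonic : c 0 = 1)
    (hsum : Summable fun i => c i ^ 2) {κ : ℝ}
    (hE : ∫ x, ‖freqResponse c x‖ ^ 2 * ‖halfBand κ (delay x)‖ ^ 2 ∂haar = 1) :
    ∀ᵐ x ∂haar, freqResponse c x = halfBand (-κ) (delay x) := by
  set H : 𝕋 → ℂ := fun x => freqResponse c x * halfBand κ (delay x) with hH
  have hL2 : MemLp H 2 haar :=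
    (memLp_halfBand_delay κ ⊤).mul (Lp.memLp (freqResponse c))
  have hint : Integrable H haar := hL2.integrable (by norm_num)
  have hsq : Integrable (fun x => ‖H x‖ ^ 2) haar :=
    (memLp_two_iff_integrable_sq_norm hL2.1).1 hL2
  -- Hence `∫ ‖H - 1‖² = ∫ ‖H‖² - 2 Re ∫ H + 1 = 1 - 2 + 1 = 0`.
  have hmean : ∫ x, (H x).re ∂haar = 1 := by
    have h1 := integral_re (𝕜 := ℂ) hint
    rw [integral_freqResponse_mul_halfBand hmonic hsum κ] at h1
    simpa using h1
  have hre : Integrable (fun x => (H x).re) haar := hint.re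
  have hexp : ∀ x, ‖H x - 1‖ ^ 2 = ‖H x‖ ^ 2 - 2 * (H x).re + 1 := by
    intro x
    rw [← Complex.normSq_eq_norm_sq, ← Complex.normSq_eq_norm_sq, Complex.normSq_apply,
      Complex.normSq_apply]
    simp; ring
  have hsub : Integrable (fun x => ‖H x‖ ^ 2 - 2 * (H x).re) haar := hsq.sub (hre.const_mul 2)
  have h0 : ∫ x, ‖H x - 1‖ ^ 2 ∂haar = 0 := by
    simp only [hexp]
    rw [integral_add hsub (integrable_const _), integral_sub hsq (hre.const_mul 2),
      integral_const_mul, hmean]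
    simp only [hH, norm_mul, mul_pow, hE]
    simp; norm_num
  have hi : Integrable (fun x => ‖H x - 1‖ ^ 2) haar := by
    simp only [hexp]; exact hsub.add (integrable_const _)
  have h1 := (integral_eq_zero_iff_of_nonneg (fun x => by positivity) hi).1 h0
  filter_upwards [h1] with x hx
  have h2 : H x = 1 := by simpa [sub_eq_zero] using hx
  calc freqResponse c x = H x * halfBand (-κ) (delay x) := by
        rw [hH]; simp only; rw [mul_assoc, halfBand_mul_neg, mul_one]
    _ = _ := by rw [h2, one_mul]

lemma coeff_eq_of_freqResponse_ae_eq {c : ℕ → ℝ} (hsum : Summable fun i => c i ^ 2) {κ : ℝ}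
    (h : ∀ᵐ x ∂haar, freqResponse c x = halfBand κ (delay x)) (n : ℕ) :
    (c n : ℂ) = halfBandCoeff κ n := by
  rw [← integral_fourier_mul_freqResponse hsum]
  have h2 := integral_fourier_mul_halfBand κ n
  rw [if_pos (by positivity), Int.toNat_natCast] at h2
  rw [← h2]
  refine integral_congr_ae ?_
  filter_upwards [h] with x hx
  rw [hx, mul_comm]

/-- A half-band outer function is not a polynomial unless it is constant: on the unit circle its
modulus jumps at `±i`. -/
lemma eq_zero_of_halfBand_eq_polynomial {κ : ℝ} {N : ℕ} {a : ℕ → ℂ}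
    (h : ∀ ζ : ℂ, ‖ζ‖ < 1 → halfBand κ ζ = ∑ i ∈ Finset.range N, a i * ζ ^ i) : κ = 0 := by
  set P : ℂ → ℂ := fun ζ => ∑ i ∈ Finset.range N, a i * ζ ^ i with hP
  have hPc : Continuous P := by fun_prop
  have hb : ∀ ζ : ℂ, ‖ζ‖ = 1 → ζ.re ≠ 0 → halfBand κ ζ = P ζ := by
    intro ζ h1 hre
    have hl : Tendsto (fun r : ℝ => (r : ℂ) * ζ) (𝓝[<] 1) (𝓝 ζ) := by
      have : Tendsto (fun r : ℝ => (r : ℂ) * ζ) (𝓝 1) (𝓝 (((1 : ℝ) : ℂ) * ζ)) := by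
        apply Continuous.tendsto
        fun_prop
      rw [Complex.ofReal_one, one_mul] at this
      exact this.mono_left nhdsWithin_le_nhds
    have hc := (differentiableAt_halfBand κ (Or.inr ⟨h1, hre⟩)).continuousAt
    refine tendsto_nhds_unique_of_eventuallyEq (hc.tendsto.comp hl)
      ((hPc.tendsto ζ).comp hl) ?_
    filter_upwards [Ioo_mem_nhdsLT (zero_lt_one' ℝ)] with r hr
    refine h _ ?_
    rw [norm_mul, h1, mul_one, Complex.norm_real, Real.norm_of_nonneg hr.1.le]
    exact hr.2
  have hpi := Real.pi_pos
  have hQ : Continuous fun ω : ℝ => ‖P (delay (ω : 𝕋))‖ :=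
    (hPc.comp (continuous_delay.comp (AddCircle.continuous_mk' _))).norm
  -- Along the unit circle the two one-sided limits at `ω = π / 2` must agree.
  have hl : ‖P (delay ((Real.pi / 2 : ℝ) : 𝕋))‖ = Real.exp (κ * (Real.pi / 4)) := by
    refine tendsto_nhds_unique ((hQ.tendsto (Real.pi / 2)).mono_left
      (nhdsWithin_le_nhds (s := Set.Iio (Real.pi / 2)))) (tendsto_const_nhds.congr' ?_)
    filter_upwards [Ioo_mem_nhdsLT (show (0 : ℝ) < Real.pi / 2 by positivity)] with ω hω
    have hc : 0 < (delay (ω : 𝕋)).re := by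
      rw [delay_coe_re]; exact Real.cos_pos_of_mem_Ioo ⟨by linarith [hω.1], hω.2⟩
    rw [← hb _ (norm_delay _) hc.ne', norm_halfBand_of_re_pos κ (norm_delay _) hc]
  have hr : ‖P (delay ((Real.pi / 2 : ℝ) : 𝕋))‖ = Real.exp (-κ * (Real.pi / 4)) := by
    refine tendsto_nhds_unique ((hQ.tendsto (Real.pi / 2)).mono_left
      (nhdsWithin_le_nhds (s := Set.Ioi (Real.pi / 2)))) (tendsto_const_nhds.congr' ?_)
    filter_upwards [Ioo_mem_nhdsGT (show Real.pi / 2 < Real.pi by linarith)] with ω hω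
    have hc : (delay (ω : 𝕋)).re < 0 := by
      rw [delay_coe_re]; exact Real.cos_neg_of_pi_div_two_lt_of_lt hω.1 (by linarith [hω.2])
    rw [← hb _ (norm_delay _) hc.ne, norm_halfBand_of_re_neg κ (norm_delay _) hc]
  have he := Real.exp_injective (hl.symm.trans hr)
  have : κ * Real.pi = 0 := by linarith
  simpa [hpi.ne'] using this

/-! ### The two-level power spectrum -/

lemma delay_re_pos {ω : ℝ} (h : |ω| < Real.pi / 2) : 0 < (delay (ω : 𝕋)).re := by
  rw [delay_coe_re]
  exact Real.cos_pos_of_mem_Ioo (abs_lt.1 h)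

lemma delay_re_neg {ω : ℝ} (h : Real.pi / 2 < |ω|) (h' : |ω| ≤ Real.pi) :
    (delay (ω : 𝕋)).re < 0 := by
  rw [delay_coe_re, ← Real.cos_abs]
  exact Real.cos_neg_of_pi_div_two_lt_of_lt h (by linarith [Real.pi_pos])

lemma integral_norm_sq_mul_halfBand {c : ℕ → ℝ} (hsum : Summable fun i => c i ^ 2) (κ : ℝ) :
    ∫ x, ‖freqResponse c x‖ ^ 2 * ‖halfBand κ (delay x)‖ ^ 2 ∂haar =
      Real.exp (-κ * (Real.pi / 4)) ^ 2 * ∑' i, c i ^ 2 +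
      (Real.exp (κ * (Real.pi / 4)) ^ 2 - Real.exp (-κ * (Real.pi / 4)) ^ 2) *
        centralPower c := by
  have hpi := Real.pi_pos
  have hsub : Set.Ioc (-(Real.pi / 2)) (Real.pi / 2) ⊆ Set.Ioc (-Real.pi) Real.pi :=
    Set.Ioc_subset_Ioc (by linarith) (by linarith)
  set u := Real.exp (κ * (Real.pi / 4)) ^ 2
  set v := Real.exp (-κ * (Real.pi / 4)) ^ 2
  have hS : IntegrableOn (powerSpectrum c) (Set.Ioc (-Real.pi) Real.pi) := by
    rw [← intervalIntegrable_iff_integrableOn_Ioc_of_le (by linarith)]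
    exact intervalIntegrable_powerSpectrum c _ _
  rw [← integral_norm_sq_freqResponse hsum, integral_haar_eq_setIntegral,
    integral_haar_eq_setIntegral, centralPower, intervalIntegral.integral_of_le (by linarith),
    ← mul_assoc, ← mul_assoc, mul_comm v, mul_comm (u - v), mul_assoc, mul_assoc, ← mul_add]
  congr 1
  have hae : ∀ᵐ ω : ℝ ∂volume.restrict (Set.Ioc (-Real.pi) Real.pi),
      ‖freqResponse c (ω : 𝕋)‖ ^ 2 * ‖halfBand κ (delay (ω : 𝕋))‖ ^ 2 =
        v * powerSpectrum c ω + (Set.Ioc (-(Real.pi / 2)) (Real.pi / 2)).indicator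
          (fun ω => (u - v) * powerSpectrum c ω) ω := by
    filter_upwards [ae_coe_of_ae_haar ae_delay_re_ne_zero,
      ae_restrict_mem measurableSet_Ioc] with ω hω hmem
    have hle : |ω| ≤ Real.pi := abs_le.2 ⟨hmem.1.le, hmem.2⟩
    by_cases hin : ω ∈ Set.Ioc (-(Real.pi / 2)) (Real.pi / 2)
    · have hlt : ω ≠ Real.pi / 2 := by
        rintro rfl; rw [delay_coe_re] at hω; simp at hω
      have h1 : |ω| < Real.pi / 2 := abs_lt.2 ⟨hin.1, lt_of_le_of_ne hin.2 hlt⟩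
      rw [Set.indicator_of_mem hin, norm_halfBand_of_re_pos κ (norm_delay _) (delay_re_pos h1)]
      simp only [powerSpectrum, u]; ring
    · have h1 : Real.pi / 2 < |ω| := by
        rw [lt_abs]
        by_contra hcon
        rw [not_or, not_lt, not_lt] at hcon
        have hlt : ω ≠ -(Real.pi / 2) := by
          rintro rfl; rw [delay_coe_re, Real.cos_neg] at hω; simp at hω
        exact hin ⟨lt_of_le_of_ne (by linarith [hcon.2]) hlt.symm, hcon.1⟩
      rw [Set.indicator_of_notMem hin, norm_halfBand_of_re_neg κ (norm_delay _)
        (delay_re_neg h1 hle)]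
      simp only [powerSpectrum, v]; ring
  have hI : Integrable ((Set.Ioc (-(Real.pi / 2)) (Real.pi / 2)).indicator
      (fun ω => (u - v) * powerSpectrum c ω))
      (volume.restrict (Set.Ioc (-Real.pi) Real.pi)) :=
    Integrable.indicator (hS.const_mul (u - v)) measurableSet_Ioc
  rw [integral_congr_ae hae, integral_add (hS.const_mul v) hI, integral_const_mul, setIntegral_indicator measurableSet_Ioc,
    Set.inter_eq_self_of_subset_right hsub, integral_const_mul]
  rfl

/-! ### The Herglotz integral of a two-level function -/

lemma log_one_add_sub_log_one_sub {ζ : ℂ} (h : ‖ζ‖ < 1) :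
    Complex.log (1 + ζ * Complex.I) - Complex.log (1 - ζ * Complex.I) =
      2 * Complex.I * Complex.arctan ζ := by
  rw [Complex.arctan, ← Complex.hasSum_arctan_aux h]
  linear_combination (Complex.log (1 + ζ * Complex.I) - Complex.log (1 - ζ * Complex.I)) *
    Complex.I_sq

/-- The Herglotz kernel is the derivative of `ω + 2i log (1 - ζ e^{iω})`, with `ζ = 1 / z`. -/
lemma hasDerivAt_herglotz {z : ℂ} (hz : 1 < ‖z‖) (ω : ℝ) :
    HasDerivAt (fun ω : ℝ => (ω : ℂ) +
        2 * Complex.I * Complex.log (1 - z⁻¹ * Complex.exp (ω * Complex.I)))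
      ((z + Complex.exp (ω * Complex.I)) / (z - Complex.exp (ω * Complex.I))) ω := by
  have hz0 : z ≠ 0 := by rintro rfl; simp at hz; linarith
  have hlt : ‖z⁻¹ * Complex.exp (ω * Complex.I)‖ < 1 := by
    rw [norm_mul, Complex.norm_exp_ofReal_mul_I, mul_one, norm_inv]
    exact inv_lt_one_of_one_lt₀ hz
  have hs : 1 - z⁻¹ * Complex.exp (ω * Complex.I) ∈ Complex.slitPlane := by
    rw [sub_eq_add_neg]
    exact Complex.mem_slitPlane_of_norm_lt_one (by rwa [norm_neg])
  have h1 : HasDerivAt (fun ω : ℝ => (ω : ℂ)) 1 ω := Complex.ofRealCLM.hasDerivAt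
  have h2 : HasDerivAt (fun ω : ℝ => 1 - z⁻¹ * Complex.exp (ω * Complex.I))
      (-(z⁻¹ * (Complex.exp (ω * Complex.I) * (1 * Complex.I)))) ω :=
    (((h1.mul_const _).cexp).const_mul z⁻¹).const_sub 1
  have h3 := h1.add ((h2.clog_real hs).const_mul (2 * Complex.I))
  have hne : 1 - z⁻¹ * Complex.exp (ω * Complex.I) ≠ 0 := Complex.slitPlane_ne_zero hs
  have hne2 : z - Complex.exp (ω * Complex.I) ≠ 0 := by
    intro h; apply hne; rw [← sub_eq_zero.1 h, inv_mul_cancel₀ hz0, sub_self]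
  refine h3.congr_deriv ?_
  have e : 1 - z⁻¹ * Complex.exp (ω * Complex.I) = z⁻¹ * (z - Complex.exp (ω * Complex.I)) := by
    field_simp
  rw [e, one_mul, ← mul_neg, mul_div_mul_left _ _ (inv_ne_zero hz0), eq_div_iff hne2, add_mul,
    mul_assoc (2 * Complex.I), div_mul_cancel₀ _ hne2]
  linear_combination (-2 * Complex.exp (ω * Complex.I)) * Complex.I_sq

/-- The Herglotz integral of a two-level half-band function. -/
lemma herglotz_integral_halfBand {z : ℂ} (hz : 1 < ‖z‖) {g : ℝ → ℝ} {l : ℝ}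
    (hin : ∀ᵐ ω : ℝ, |ω| < Real.pi / 2 → g ω = -l)
    (hout : ∀ᵐ ω : ℝ, Real.pi / 2 < |ω| → |ω| < Real.pi → g ω = l) :
    ∫ ω in (-Real.pi)..Real.pi,
        (z + Complex.exp (ω * Complex.I)) / (z - Complex.exp (ω * Complex.I)) * (g ω : ℂ) =
      -8 * l * Complex.arctan z⁻¹ := by
  have hpi := Real.pi_pos
  set k : ℝ → ℂ := fun ω =>
    (z + Complex.exp (ω * Complex.I)) / (z - Complex.exp (ω * Complex.I)) with hk
  set A : ℝ → ℂ := fun ω => (ω : ℂ) +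
        2 * Complex.I * Complex.log (1 - z⁻¹ * Complex.exp (ω * Complex.I)) with hA
  have hkc : Continuous k := by
    refine Continuous.div (by fun_prop) (by fun_prop) fun ω h => ?_
    rw [sub_eq_zero.1 h, Complex.norm_exp_ofReal_mul_I] at hz
    exact lt_irrefl _ hz
  have hFTC : ∀ a b : ℝ, ∫ ω in a..b, k ω = A b - A a := fun a b =>
    intervalIntegral.integral_eq_sub_of_hasDerivAt (fun ω _ => hasDerivAt_herglotz hz ω)
      (hkc.intervalIntegrable a b)
  -- On each of the three arcs the two-level function is a.e. constant.
  have hpiece : ∀ (a b t : ℝ), a ≤ b → (∀ᵐ ω : ℝ, ω ∈ Set.Ioo a b → g ω = t) →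
      IntervalIntegrable (fun ω => k ω * (g ω : ℂ)) volume a b ∧
        ∫ ω in a..b, k ω * (g ω : ℂ) = t * (A b - A a) := by
    intro a b t hab h
    have h1 : ∀ᵐ ω : ℝ, ω ∈ Set.uIoc a b → k ω * (t : ℂ) = k ω * (g ω : ℂ) := by
      have hb : ∀ᵐ ω : ℝ, ω ≠ b := by simp [ae_iff]
      filter_upwards [h, hb] with ω hω hωb hmem
      rw [Set.uIoc_of_le hab] at hmem
      rw [hω ⟨hmem.1, lt_of_le_of_ne hmem.2 hωb⟩]
    refine ⟨((hkc.mul continuous_const).intervalIntegrable a b).congr_ae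
      ((ae_restrict_iff' measurableSet_uIoc).2 h1), ?_⟩
    rw [← intervalIntegral.integral_congr_ae h1, intervalIntegral.integral_mul_const, hFTC,
      mul_comm]
  obtain ⟨i1, e1⟩ := hpiece (-Real.pi) (-(Real.pi / 2)) l (by linarith) (by
    filter_upwards [hout] with ω h hω
    rw [abs_of_neg (by linarith [hω.2])] at h
    exact h (by linarith [hω.2]) (by linarith [hω.1]))
  obtain ⟨i2, e2⟩ := hpiece (-(Real.pi / 2)) (Real.pi / 2) (-l) (by linarith) (by
    filter_upwards [hin] with ω h hω using h (abs_lt.2 hω))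
  obtain ⟨i3, e3⟩ := hpiece (Real.pi / 2) Real.pi l (by linarith) (by
    filter_upwards [hout] with ω h hω
    rw [abs_of_pos (by linarith [hω.1])] at h
    exact h hω.1 hω.2)
  have hlog := log_one_add_sub_log_one_sub (ζ := z⁻¹)
    (by rw [norm_inv]; exact inv_lt_one_of_one_lt₀ hz)
  have hA1 : A (Real.pi / 2) = (Real.pi / 2 : ℂ) +
      2 * Complex.I * Complex.log (1 - z⁻¹ * Complex.I) := by
    simp only [hA]; push_cast; rw [Complex.exp_pi_div_two_mul_I]
  have hA2 : A (-(Real.pi / 2)) = -(Real.pi / 2 : ℂ) +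
      2 * Complex.I * Complex.log (1 + z⁻¹ * Complex.I) := by
    simp only [hA]; push_cast
    rw [← neg_div, Complex.exp_neg_pi_div_two_mul_I, mul_neg, sub_neg_eq_add]
  have hA3 : A Real.pi - A (-Real.pi) = 2 * Real.pi := by
    simp only [hA]; push_cast
    rw [Complex.exp_pi_mul_I, neg_mul, Complex.exp_neg, Complex.exp_pi_mul_I]; norm_num; ring
  rw [← intervalIntegral.integral_add_adjacent_intervals (i1.trans i2) i3,
    ← intervalIntegral.integral_add_adjacent_intervals i1 i2, e1, e2, e3]
  have hA3' : A Real.pi = A (-Real.pi) + 2 * Real.pi := by rw [← hA3]; ring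
  rw [hA1, hA2, hA3']
  push_cast
  have hlog' : Complex.log (1 + z⁻¹ * Complex.I) =
      Complex.log (1 - z⁻¹ * Complex.I) + 2 * Complex.I * Complex.arctan z⁻¹ := by
    rw [← hlog]; ring
  rw [hlog']
  linear_combination (8 * l * Complex.arctan z⁻¹) * Complex.I_sq

/-! ### Ozarow's bound as a relation between powers -/

/-- Ozarow's bound is met exactly when the in-band noise power `p` and the total noise power `s`
satisfy `2p = s - √(s² - 1) = (s + √(s² - 1))⁻¹`. -/
lemma two_mul_eq_one_of_ozarow {V E s p x : ℝ} (hV : 0 < V) (hE : 0 < E) (hs : 1 ≤ s)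
    (hp : 0 ≤ p) (hx : x = (E / (V + E * s)) ^ 2)
    (h : V * (E * p) / (V + E * p) =
      V * x / (1 - (Real.sqrt ((1 - V * (E * s) / (V + E * s) / V) ^ 2) -
        Real.sqrt ((V * (E * s) / (V + E * s)) ^ 2 / V ^ 2 - x)) ^ 2)) :
    2 * p * (s + Real.sqrt (s ^ 2 - 1)) = 1 := by
  set r := Real.sqrt (s ^ 2 - 1) with hr
  have hr0 : 0 ≤ r := Real.sqrt_nonneg _
  have hr2 : r ^ 2 = s ^ 2 - 1 := Real.sq_sqrt (by nlinarith)
  have hrs : r < s := by nlinarith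
  have hs0 : 0 < s := by linarith
  have hM : 0 < V + E * s := by positivity
  have h1 : Real.sqrt ((1 - V * (E * s) / (V + E * s) / V) ^ 2) = V / (V + E * s) := by
    rw [show 1 - V * (E * s) / (V + E * s) / V = V / (V + E * s) by field_simp; ring,
      Real.sqrt_sq (by positivity)]
  have h2 : Real.sqrt ((V * (E * s) / (V + E * s)) ^ 2 / V ^ 2 - x) = E * r / (V + E * s) := by
    rw [show (V * (E * s) / (V + E * s)) ^ 2 / V ^ 2 - x = (E * r / (V + E * s)) ^ 2 by
      rw [hx, div_pow (E * r), mul_pow E r, hr2]; field_simp, Real.sqrt_sq (by positivity)]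
  have hD : 0 < 2 * V + E * (s - r) := by
    have := mul_pos hE (sub_pos.2 hrs); linarith
  have h3 : 1 - (V / (V + E * s) - E * r / (V + E * s)) ^ 2 =
      E * (s + r) * (2 * V + E * (s - r)) / (V + E * s) ^ 2 := by
    field_simp; ring
  rw [h1, h2, h3, hx] at h
  have hsr : 0 < s + r := by linarith
  have h4 : V * (E / (V + E * s)) ^ 2 /
      (E * (s + r) * (2 * V + E * (s - r)) / (V + E * s) ^ 2) =
      V * E / ((s + r) * (2 * V + E * (s - r))) := by
    field_simp
  have hq : 0 < V + E * p := by positivity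
  rw [h4, div_eq_div_iff hq.ne' (by positivity)] at h
  have h5 : V * E * V * (2 * p * (s + r)) = V * E * V * 1 := by
    linear_combination h + V * E * E * p * hr2
  exact mul_left_cancel₀ (by positivity) h5

lemma two_rpow_neg_four_mul_descriptionRate (σX2 σE2 : NNReal) (hE : 0 < σE2)
    (c : ℕ → ℝ) (hmonic : c 0 = 1) (hsum : Summable fun i => c i ^ 2) :
    (2 : ℝ) ^ (-4 * descriptionRate σX2 σE2 c) =
      (σE2 / (σX2 + σE2 * ∑' i, c i ^ 2)) ^ 2 := by
  have hE' : (0 : ℝ) < σE2 := hE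
  have hX' : (0 : ℝ) ≤ σX2 := σX2.2
  have hq : 0 ≤ ∑' i, c (i + 1) ^ 2 := tsum_nonneg fun i => sq_nonneg _
  have hs : ∑' i, c i ^ 2 = 1 + ∑' i, c (i + 1) ^ 2 := by
    rw [hsum.tsum_eq_zero_add, hmonic, one_pow]
  have hv : ((quantizerInputVar σX2 σE2 c : ℝ) + σE2) / σE2 =
      (σX2 + σE2 * ∑' i, c i ^ 2) / σE2 := by
    rw [quantizerInputVar, NNReal.coe_add, NNReal.coe_mul, Real.coe_toNNReal _ hq, hs]; ring
  have hpos : 0 < (σX2 + σE2 * ∑' i, c i ^ 2) / (σE2 : ℝ) := by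
    rw [hs]; positivity
  rw [descriptionRate, mutualInfo_gaussian_channel _ _ hE.ne', hv,
    Real.rpow_def_of_pos two_pos]
  have hl2 : Real.log 2 ≠ 0 := (Real.log_pos one_lt_two).ne'
  rw [show Real.log 2 * (-4 * (Real.log ((σX2 + σE2 * ∑' i, c i ^ 2) / (σE2 : ℝ)) / 2 /
      Real.log 2)) = -(2 * Real.log ((σX2 + σE2 * ∑' i, c i ^ 2) / (σE2 : ℝ))) by
      field_simp; ring, Real.exp_neg, two_mul, Real.exp_add, Real.exp_log hpos, ← inv_div]
  rw [← mul_inv, inv_inv, sq]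

/-- Achieving the rate-distortion function is a relation between in-band and total power. -/
lemma AchievesRDF.centralPower_mul_eq_one {σX2 σE2 : NNReal} (hX : 0 < σX2) (hE : 0 < σE2)
    {c : ℕ → ℝ} (hmonic : c 0 = 1) (hsum : Summable fun i => c i ^ 2)
    (hach : AchievesRDF σX2 σE2 c) :
    2 * centralPower c * (∑' i, c i ^ 2 + Real.sqrt ((∑' i, c i ^ 2) ^ 2 - 1)) = 1 := by
  have hs : 1 ≤ ∑' i, c i ^ 2 := by
    have := hsum.le_tsum 0 fun i _ => sq_nonneg _
    simpa [hmonic] using this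
  have h := hach.2
  rw [centralDistortion, sideDistortion, distortion_eq _ _ hX, distortion_eq _ _ hX,
    sidePower_eq hsum, ozarowCentral, ozarowPi, ozarowDelta, NNReal.coe_mul, NNReal.coe_mul,
    Real.coe_toNNReal _ (centralPower_nonneg c), Real.coe_toNNReal _ (by linarith)] at h
  exact two_mul_eq_one_of_ozarow hX hE hs (centralPower_nonneg c)
    (two_rpow_neg_four_mul_descriptionRate σX2 σE2 hE c hmonic hsum) h

/-! ### Half-band outer filters are minimum phase -/

lemma transfer_eq_halfBand {c : ℕ → ℝ} {κ : ℝ} (hc : ∀ n, (c n : ℂ) = halfBandCoeff κ n)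
    {z : ℂ} (hz : 1 < ‖z‖) : transfer c z = halfBand κ z⁻¹ := by
  have h := hasSum_halfBand κ z⁻¹ (by rw [norm_inv]; exact inv_lt_one_of_one_lt₀ hz)
  simp only [← hc] at h
  exact h.tsum_eq

lemma measurable_powerSpectrum (c : ℕ → ℝ) : Measurable (powerSpectrum c) :=
  ((Lp.stronglyMeasurable (freqResponse c)).measurable.comp
    measurePreserving_coe.measurable).norm.pow_const 2

lemma powerSpectrum_ae_eq {c : ℕ → ℝ} {κ : ℝ}
    (h : ∀ᵐ x ∂haar, freqResponse c x = halfBand κ (delay x)) :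
    ∀ᵐ ω : ℝ, (|ω| < Real.pi / 2 → powerSpectrum c ω = Real.exp (κ * (Real.pi / 2))) ∧
      (Real.pi / 2 < |ω| → |ω| < Real.pi →
        powerSpectrum c ω = Real.exp (-(κ * (Real.pi / 2)))) := by
  have hpi := Real.pi_pos
  filter_upwards [(ae_restrict_iff' measurableSet_Ioc).1 (ae_coe_of_ae_haar h)] with ω hω
  constructor
  · intro h1
    have h2 := abs_lt.1 h1
    rw [powerSpectrum, hω ⟨by linarith, by linarith⟩,
      norm_halfBand_of_re_pos κ (norm_delay _) (delay_re_pos h1), ← Real.exp_nat_mul]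
    congr 1; push_cast; ring
  · intro h1 h1'
    have h2 := abs_lt.1 h1'
    rw [powerSpectrum, hω ⟨by linarith, by linarith⟩,
      norm_halfBand_of_re_neg κ (norm_delay _) (delay_re_neg h1 h1'.le), ← Real.exp_nat_mul]
    congr 1; push_cast; ring

/-- A half-band outer filter is minimum phase. -/
lemma isMinimumPhase_of_freqResponse_ae_eq {c : ℕ → ℝ} (hsum : Summable fun i => c i ^ 2) {κ : ℝ}
    (h : ∀ᵐ x ∂haar, freqResponse c x = halfBand κ (delay x)) : IsMinimumPhase c := by
  have hpi := Real.pi_pos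
  have hS := powerSpectrum_ae_eq h
  have hin : ∀ᵐ ω : ℝ, |ω| < Real.pi / 2 →
      Real.log (powerSpectrum c ω) = -(-(κ * (Real.pi / 2))) := by
    filter_upwards [hS] with ω hω h1
    rw [hω.1 h1, Real.log_exp, neg_neg]
  have hout : ∀ᵐ ω : ℝ, Real.pi / 2 < |ω| → |ω| < Real.pi →
      Real.log (powerSpectrum c ω) = -(κ * (Real.pi / 2)) := by
    filter_upwards [hS] with ω hω h1 h2
    rw [hω.2 h1 h2, Real.log_exp]
  refine ⟨?_, 1, norm_one, fun z hz => ?_⟩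
  · refine Measure.integrableOn_of_bounded (M := |κ * (Real.pi / 2)|) (by simp)
      (Real.measurable_log.comp (measurable_powerSpectrum c)).aestronglyMeasurable ?_
    rw [ae_restrict_iff' measurableSet_Ioc]
    have hne : ∀ a : ℝ, ∀ᵐ ω : ℝ, ω ≠ a := fun a => by simp [ae_iff]
    filter_upwards [hin, hout, hne Real.pi, hne (Real.pi / 2), hne (-(Real.pi / 2))]
      with ω h1 h2 n1 n2 n3 hmem
    rcases lt_trichotomy |ω| (Real.pi / 2) with hlt | heq | hgt
    · rw [h1 hlt, neg_neg, Real.norm_eq_abs]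
    · rcases (abs_eq (by positivity)).1 heq with h | h
      · exact absurd h n2
      · exact absurd h n3
    · rw [h2 hgt (abs_lt.2 ⟨hmem.1, lt_of_le_of_ne hmem.2 n1⟩), Real.norm_eq_abs, abs_neg]
  · rw [transfer_eq_halfBand (coeff_eq_of_freqResponse_ae_eq hsum h) hz,
      herglotz_integral_halfBand hz hin hout, one_mul, halfBand]
    congr 1
    have : (Real.pi : ℂ) ≠ 0 := by exact_mod_cast hpi.ne'
    push_cast
    field_simp
    ring

end DeltaSigma

end

theorem mainTheorem2 (σX2 σE2 : NNReal) (hX : 0 < σX2) (hE : 0 < σE2)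
    (c : ℕ → ℝ) (hmonic : c 0 = 1) (hsum : Summable fun i => c i ^ 2)
    (hach : DeltaSigma.AchievesRDF σX2 σE2 c) :
    ∃ δ : ℝ, 1 ≤ δ ∧
      (∀ᵐ ω : ℝ ∂MeasureTheory.volume,
        |ω| < Real.pi / 2 → DeltaSigma.powerSpectrum c ω = δ⁻¹) ∧
      (∀ᵐ ω : ℝ ∂MeasureTheory.volume,
        Real.pi / 2 < |ω| → |ω| < Real.pi → DeltaSigma.powerSpectrum c ω = δ) ∧
      DeltaSigma.IsMinimumPhase c ∧
      (DeltaSigma.HasInfiniteOrder c ∨ (δ = 1 ∧ c = Pi.single 0 1)) := by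
  have hpi := Real.pi_pos
  have hp := hach.centralPower_mul_eq_one hX hE hmonic hsum
  have hs : 1 ≤ ∑' i, c i ^ 2 := by
    have := hsum.le_tsum 0 fun i _ => sq_nonneg _
    simpa [hmonic] using this
  set s := ∑' i, c i ^ 2 with hsdef
  set r := Real.sqrt (s ^ 2 - 1) with hr
  have hr0 : 0 ≤ r := Real.sqrt_nonneg _
  have hr2 : r ^ 2 = s ^ 2 - 1 := Real.sq_sqrt (by nlinarith)
  -- `δ` is the out-of-band average of the spectrum; the in-band average `s - r` is its inverse.
  set δ := s + r with hδ
  have hδ1 : 1 ≤ δ := by linarith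
  have hδ0 : 0 < δ := by linarith
  have hδinv : δ⁻¹ = s - r := by
    refine inv_eq_of_mul_eq_one_right ?_
    rw [hδ]; linear_combination -hr2
  -- This `κ` makes `‖halfBand κ‖²` equal to `δ` in band and `δ⁻¹` out of band, so that
  -- `halfBand κ` whitens the two-level spectrum.
  set κ := 2 * Real.log δ / Real.pi with hκ
  have hκpi : κ * (Real.pi / 2) = Real.log δ := by rw [hκ]; field_simp
  have he1 : Real.exp (κ * (Real.pi / 4)) ^ 2 = δ := by
    rw [← Real.exp_nat_mul, show ((2 : ℕ) : ℝ) * (κ * (Real.pi / 4)) = Real.log δ by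
      rw [← hκpi]; push_cast; ring, Real.exp_log hδ0]
  have he2 : Real.exp (-κ * (Real.pi / 4)) ^ 2 = δ⁻¹ := by
    rw [neg_mul, Real.exp_neg, inv_pow, he1]
  have hE1 := DeltaSigma.integral_norm_sq_mul_halfBand hsum κ
  rw [he1, he2, ← hsdef] at hE1
  have hpc : DeltaSigma.centralPower c = δ⁻¹ / 2 := by field_simp; linarith
  have hone : δ⁻¹ * s + (δ - δ⁻¹) * DeltaSigma.centralPower c = 1 := by
    rw [hpc, hδinv, hδ]; linear_combination -hr2
  rw [hone] at hE1
  have hf := DeltaSigma.freqResponse_ae_eq_halfBand hmonic hsum hE1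
  have hS := DeltaSigma.powerSpectrum_ae_eq hf
  rw [neg_mul, hκpi, neg_neg, Real.exp_neg, Real.exp_log hδ0] at hS
  refine ⟨δ, hδ1, hS.mono fun ω h => h.1, hS.mono fun ω h => h.2,
    DeltaSigma.isMinimumPhase_of_freqResponse_ae_eq hsum hf, ?_⟩
  refine or_iff_not_imp_left.2 fun hfin => ?_
  obtain ⟨N, hN⟩ := not_not.1 hfin
  -- A finite-order filter makes `halfBand (-κ)` a polynomial.
  have hκ0 : -κ = 0 := by
    refine DeltaSigma.eq_zero_of_halfBand_eq_polynomial (N := N + 1) (a := fun i => (c i : ℂ)) ?_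
    intro ζ hζ
    have h := DeltaSigma.hasSum_halfBand (-κ) ζ hζ
    simp only [← DeltaSigma.coeff_eq_of_freqResponse_ae_eq hsum hf] at h
    refine h.unique (hasSum_sum_of_ne_finset_zero fun i hi => ?_)
    rw [hN i (by simpa using hi)]; simp
  have hδeq : δ = 1 := by
    rw [← Real.exp_log hδ0, ← hκpi, neg_eq_zero.1 hκ0, zero_mul, Real.exp_zero]
  refine ⟨hδeq, ?_⟩
  -- From `s + r = 1`, `1 ≤ s` and `0 ≤ r` it follows that `s = 1`: the energy is all in `c 0`.
  have htail : ∑' i, c (i + 1) ^ 2 = 0 := by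
    have : s = 1 + ∑' i, c (i + 1) ^ 2 := by
      rw [hsdef, hsum.tsum_eq_zero_add, hmonic, one_pow]
    linarith
  funext i
  cases i with
  | zero => simpa using hmonic
  | succ i =>
    have h1 := ((summable_nat_add_iff 1).2 hsum).le_tsum i fun j _ => sq_nonneg _
    rw [htail] at h1
    simpa using pow_eq_zero_iff two_ne_zero |>.1 (le_antisymm h1 (sq_nonneg _))
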